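/- Let $\mu$ be a finite Borel measure on $\mathbb{C}$ whose support is compact and infinite, and let $\varphi_n=\varphi_n(\cdot\,;\mu)$ be its orthonormal polynomials, obtained by Gram–Schmidt orthogonalization of $1,z,z^2,\dots$ in $L^2(\mu)$ and normalized so that the leading coefficient of $\varphi_n$ is positive. Let $K\subset\mathbb{C}$ be a compact set bounded by a Jordan curve, let $\phi_K$ denote the conformal bijection of $\overline{\mathbb{C}}\setminus K$ onto $\overline{\mathbb{C}}\setminus\overline{\mathbb{D}}$ with $\phi_K(\infty)=\infty$ and $\phi_K'(\infty):=\lim_{z\to\infty}\phi_K(z)/z>0$, and let $\psi_K$ be its inverse. Suppose that for some $R$ $$\lim_{n\to\infty}\frac{\varphi_n(z)}{\varphi_{n+1}(z)}=\frac{1}{\phi_K(z)}\qquad\text{for all } |z|>R .$$ Then for every integer $j\ge 0$ $$\lim_{n\to\infty}\int_{\mathbb{C}}z^j|\varphi_n(z)|^2\,d\mu(z)=\int_0^{2\pi}\psi_K(e^{i\theta})^j\,\frac{d\theta}{2\pi}.$$ Here $\psi_K(e^{i\theta})$ is the boundary value $\lim_{r\downarrow 1}\psi_K(re^{i\theta})$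 (the value of the continuous extension of $\psi_K$ to the unit circle); part of the assertion is that this limit exists for almost every $\theta$ and that the integrand on the right is integrable. -/

import Mathlib

open Filter Topology MeasureTheory Polynomial

noncomputable section

/-- The sesquilinear pairing `∫ p(z) \overline{q(z)} dμ(z)` of two polynomials. -/
def polyInner (μ : Measure ℂ) (p q : ℂ[X]) : ℂ :=
  ∫ z, p.eval z * (starRingEnd ℂ) (q.eval z) ∂μ

/-- The monic orthogonal polynomials `Φ_n(·; μ)`: Gram-Schmidt orthogonalization (without
normalization) of `1, z, z², …` in `L²(μ)`. -/
def monicOrthoPoly (μ : Measure ℂ) (n : ℕ) : ℂ[X] :=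
  X ^ n - ∑ k : Fin n,
    C (polyInner μ (X ^ n) (monicOrthoPoly μ k) /
      polyInner μ (monicOrthoPoly μ k) (monicOrthoPoly μ k)) * monicOrthoPoly μ k
termination_by n
decreasing_by all_goals exact k.2

/-- The orthonormal polynomials `φ_n(·; μ) = Φ_n / ‖Φ_n‖_{L²(μ)}`. -/
def orthonormalPoly (μ : Measure ℂ) (n : ℕ) : ℂ[X] :=
  C (((Real.sqrt (∫ z, ‖(monicOrthoPoly μ n).eval z‖ ^ 2 ∂μ))⁻¹ : ℝ) : ℂ) * monicOrthoPoly μ n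

/-- A Jordan curve in the plane: an injective continuous image of the unit circle. -/
def IsJordanCurve (J : Set ℂ) : Prop :=
  ∃ γ : Circle → ℂ, Continuous γ ∧ Function.Injective γ ∧ Set.range γ = J

/-- `φ` is the conformal bijection from the complement of `K` onto the complement of the closed
unit disk, both in the extended plane, with `φ(∞) = ∞` and `φ'(∞) > 0`. The point at infinity is
expressed through the filter `Bornology.cobounded ℂ` of its punctured neighbourhoods, and `φ'(∞)`
is the leading coefficient `lim φ(z) / z`. The values of `φ` on `K` are irrelevant. -/
structure IsExteriorConformalMap (K : Set ℂ) (φ : ℂ → ℂ) : Prop where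
  differentiableOn : DifferentiableOn ℂ φ Kᶜ
  bijOn : Set.BijOn φ Kᶜ {w : ℂ | 1 < ‖w‖}
  map_infty : Tendsto φ (Bornology.cobounded ℂ) (Bornology.cobounded ℂ)
  deriv_infty_pos : ∃ c : ℝ, 0 < c ∧
    Tendsto (fun z : ℂ => φ z / z) (Bornology.cobounded ℂ) (𝓝 (c : ℂ))

/-- The boundary value at a point `ζ` of the unit circle of a function `ψ` given on `|w| > 1`: the
radial limit from outside. If `ψ` extends continuously to `|w| ≥ 1`, this is the value at `ζ` of
the extension, see `exteriorBoundaryValue_eq`. -/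
def exteriorBoundaryValue (ψ : ℂ → ℂ) (ζ : ℂ) : ℂ :=
  limUnder (𝓝[>] (1 : ℝ)) (fun r : ℝ => ψ ((r : ℂ) * ζ))

/-- The boundary values are those of the continuous extension, where there is one. -/
theorem exteriorBoundaryValue_eq {ψ Ψ : ℂ → ℂ} (hΨ : ContinuousOn Ψ {w : ℂ | 1 ≤ ‖w‖})
    (hext : Set.EqOn Ψ ψ {w : ℂ | 1 < ‖w‖}) {ζ : ℂ} (hζ : ‖ζ‖ = 1) :
    exteriorBoundaryValue ψ ζ = Ψ ζ := by
  apply Tendsto.limUnder_eq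
  have h1 : Tendsto (fun r : ℝ => (r : ℂ) * ζ) (𝓝[>] (1 : ℝ)) (𝓝[{w : ℂ | 1 ≤ ‖w‖}] ζ) := by
    refine tendsto_nhdsWithin_iff.2 ⟨?_, ?_⟩
    · have : Continuous (fun r : ℝ => (r : ℂ) * ζ) := by fun_prop
      simpa using (this.tendsto 1).mono_left nhdsWithin_le_nhds
    · filter_upwards [self_mem_nhdsWithin] with r hr
      have hr' : (1 : ℝ) < r := hr
      change 1 ≤ ‖_‖
      simp only [norm_mul, Complex.norm_real, hζ, mul_one, Real.norm_eq_abs]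
      exact hr'.le.trans (le_abs_self r)
  refine ((hΨ ζ (by simp [hζ])).tendsto.comp h1).congr' ?_
  filter_upwards [self_mem_nhdsWithin] with r hr
  have hr' : (1 : ℝ) < r := hr
  apply hext
  change 1 < ‖_‖
  simp only [norm_mul, Complex.norm_real, hζ, mul_one, Real.norm_eq_abs]
  exact hr'.trans_le (le_abs_self r)

end

/-!
Multiplication by `z` is a Hessenberg matrix in the basis `φ_n`, and expanding `z^j φ_n` in this
basis and dividing by `φ_{n+j}` writes `z^j φ_n(z) / φ_{n+j}(z)` as a power series in ratios
`φ_k(z) / φ_{n+j}(z)`, whose coefficients are the entries of the `j`-th power of that matrix along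
a row. Far out the ratios tend to powers of `1 / φ_K(z)`; hence, with `z = ψ_K(w)`, every limit
point of the rows is the sequence of coefficients of `(ψ_K(w) / w)^j` in powers of `1 / w`, and by
compactness the rows converge to it. The diagonal entry is `∫ z^j |φ_n|² dμ`, and its limit is the
mean of `ψ_K^j` over a circle `|w| = ρ > 1`.

It remains to let `ρ ↓ 1`. The area of `ψ_K({1 < |w| < 2})` is finite, so by Fubini `ψ_K'` is
square integrable along almost every ray, on which `ψ_K` therefore has a limit at `|w| = 1`.
-/

open scoped InnerProductSpace

noncomputable section

section OrthonormalPolynomials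

variable {𝕜 E : Type*} [RCLike 𝕜] [NormedAddCommGroup E] [InnerProductSpace 𝕜 E]
  {ι : 𝕜[X] →ₗ[𝕜] E} {S : Polynomial.Sequence 𝕜}

theorem mem_span_seq_of_degree_lt {n : ℕ} {p : 𝕜[X]} (hp : p.degree < n) :
    p ∈ Submodule.span 𝕜 (S '' Set.Iio n) := by
  rw [S.span_degreeLT fun i _ => (leadingCoeff_ne_zero.2 (S.ne_zero i)).isUnit]
  exact mem_degreeLT.2 hp

theorem inner_seq_eq_zero_of_degree_lt (hS : Orthonormal 𝕜 fun n => ι (S n)) {n : ℕ} {p : 𝕜[X]}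
    (hp : p.degree < n) : ⟪ι (S n), ι p⟫_𝕜 = 0 := by
  replace hp := mem_span_seq_of_degree_lt (S := S) hp
  induction hp using Submodule.span_induction with
  | mem q hq =>
    obtain ⟨k, hk, rfl⟩ := hq
    exact hS.2 (ne_of_gt hk)
  | zero => simp
  | add p q _ _ hp hq => rw [map_add, inner_add_right, hp, hq, add_zero]
  | smul c p _ hp => rw [map_smul, inner_smul_right, hp, mul_zero]

theorem eq_sum_inner_smul_seq (hS : Orthonormal 𝕜 fun n => ι (S n)) {N : ℕ} {p : 𝕜[X]}
    (hp : p.degree < N) : p = ∑ k ∈ Finset.range N, ⟪ι (S k), ι p⟫_𝕜 • S k := by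
  replace hp := mem_span_seq_of_degree_lt (S := S) hp
  induction hp using Submodule.span_induction with
  | mem q hq =>
    obtain ⟨i, hi, rfl⟩ := hq
    rw [Finset.sum_eq_single_of_mem i (Finset.mem_range.2 hi)]
    · rw [inner_self_eq_norm_sq_to_K, hS.1 i]; simp
    · intro k _ hk
      rw [hS.2 hk, zero_smul]
  | zero => simp
  | add p q _ _ hp hq =>
    simp only [map_add, inner_add_right, add_smul, Finset.sum_add_distrib]
    rw [← hp, ← hq]
  | smul c p _ hp =>
    simp only [map_smul, inner_smul_right, mul_smul, ← Finset.smul_sum]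
    rw [← hp]

variable {R : ℝ}

theorem norm_X_pow_mul_le (hι : ∀ p, ‖ι (X * p)‖ ≤ R * ‖ι p‖) (hR : 0 ≤ R) (j : ℕ) (p : 𝕜[X]) :
    ‖ι (X ^ j * p)‖ ≤ R ^ j * ‖ι p‖ := by
  induction j with
  | zero => simp
  | succ j ih =>
    calc ‖ι (X ^ (j + 1) * p)‖ = ‖ι (X * (X ^ j * p))‖ := by rw [pow_succ', mul_assoc]
      _ ≤ R * ‖ι (X ^ j * p)‖ := hι _
      _ ≤ R * (R ^ j * ‖ι p‖) := by gcongr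
      _ = R ^ (j + 1) * ‖ι p‖ := by ring

theorem nonneg_of_norm_X_mul_le (hS : Orthonormal 𝕜 fun n => ι (S n))
    (hι : ∀ p, ‖ι (X * p)‖ ≤ R * ‖ι p‖) : 0 ≤ R := by
  simpa [hS.1 0] using (norm_nonneg _).trans (hι (S 0))

theorem sub_mul_norm_sq_le_norm_inner (hι : ∀ p, ‖ι (X * p)‖ ≤ R * ‖ι p‖) (z : 𝕜) (v : 𝕜[X]) :
    (‖z‖ - R) * ‖ι v‖ ^ 2 ≤ ‖⟪ι v, ι ((X - C z) * v)⟫_𝕜‖ := by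
  have hX : ‖⟪ι v, ι (X * v)⟫_𝕜‖ ≤ R * ‖ι v‖ ^ 2 :=
    calc ‖⟪ι v, ι (X * v)⟫_𝕜‖ ≤ ‖ι v‖ * ‖ι (X * v)‖ := norm_inner_le_norm _ _
      _ ≤ ‖ι v‖ * (R * ‖ι v‖) := by gcongr; exact hι v
      _ = R * ‖ι v‖ ^ 2 := by ring
  calc (‖z‖ - R) * ‖ι v‖ ^ 2 ≤ ‖z‖ * ‖ι v‖ ^ 2 - ‖⟪ι v, ι (X * v)⟫_𝕜‖ := by linarith
    _ = ‖z * ⟪ι v, ι v⟫_𝕜‖ - ‖⟪ι v, ι (X * v)⟫_𝕜‖ := by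
      rw [norm_mul, inner_self_eq_norm_sq_to_K, norm_pow, RCLike.norm_ofReal, abs_norm]
    _ ≤ ‖⟪ι v, ι (X * v)⟫_𝕜 - z * ⟪ι v, ι v⟫_𝕜‖ := by
      rw [norm_sub_rev]
      exact norm_sub_norm_le _ _
    _ = ‖⟪ι v, ι ((X - C z) * v)⟫_𝕜‖ := by
      rw [sub_mul, ← smul_eq_C_mul, map_sub, map_smul, inner_sub_right, inner_smul_right]

theorem exists_eq_X_sub_C_mul_of_isRoot {F : Type*} [Field F] {p : F[X]} {z : F} (hz : p.IsRoot z)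
    {n : ℕ} (hp : p.degree < (n + 1 : ℕ)) : ∃ v : F[X], p = (X - C z) * v ∧ v.degree < n := by
  obtain ⟨v, rfl⟩ := dvd_iff_isRoot.2 hz
  refine ⟨v, rfl, ?_⟩
  rw [degree_mul, degree_X_sub_C, add_comm, Nat.cast_succ] at hp
  exact lt_of_add_lt_add_right hp

theorem eval_seq_ne_zero_of_lt_norm (hS : Orthonormal 𝕜 fun n => ι (S n))
    (hι : ∀ p, ‖ι (X * p)‖ ≤ R * ‖ι p‖) {z : 𝕜} (hz : R < ‖z‖) (n : ℕ) : (S n).eval z ≠ 0 := by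
  intro hroot
  obtain ⟨v, hv, hdeg⟩ := exists_eq_X_sub_C_mul_of_isRoot (n := n) hroot
    (by rw [S.degree_eq]; exact_mod_cast n.lt_succ_self)
  have hle := sub_mul_norm_sq_le_norm_inner hι z v
  rw [← hv, inner_eq_zero_symm.1 (inner_seq_eq_zero_of_degree_lt hS hdeg), norm_zero] at hle
  have hv0 : ‖ι v‖ = 0 := by
    by_contra h
    have : 0 < (‖z‖ - R) * ‖ι v‖ ^ 2 := mul_pos (sub_pos.2 hz) (by positivity)
    linarith
  have hXv : ι (X * v) = 0 := norm_le_zero_iff.1 ((hι v).trans_eq (by rw [hv0, mul_zero]))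
  refine hS.ne_zero n ?_
  rw [hv, sub_mul, ← smul_eq_C_mul, map_sub, map_smul, hXv, norm_eq_zero.1 hv0, smul_zero,
    sub_zero]

theorem norm_eval_seq_div_succ_le (hS : Orthonormal 𝕜 fun n => ι (S n))
    (hι : ∀ p, ‖ι (X * p)‖ ≤ R * ‖ι p‖) {z : 𝕜} (hz : R < ‖z‖) (n : ℕ) :
    ‖(S n).eval z / (S (n + 1)).eval z‖ ≤ R / (‖z‖ - R) := by
  have hR := nonneg_of_norm_X_mul_le hS hι
  set ρ := (S n).eval z / (S (n + 1)).eval z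
  have hne := eval_seq_ne_zero_of_lt_norm hS hι hz (n + 1)
  have hd : 0 < ‖z‖ - R := sub_pos.2 hz
  obtain ⟨v, hv, hdeg⟩ := exists_eq_X_sub_C_mul_of_isRoot (n := n + 1) (p := S n - ρ • S (n + 1))
    (z := z) (by simp [ρ, hne])
    ((degree_sub_le _ _).trans_lt (max_lt (by rw [S.degree_eq]; norm_cast; omega)
      ((degree_smul_le _ _).trans_lt (by rw [S.degree_eq]; norm_cast; omega))))
  have horth : ⟪ι (S (n + 1)), ι v⟫_𝕜 = 0 := inner_seq_eq_zero_of_degree_lt hS hdeg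
  have hv_norm : ‖ι v‖ ≤ (‖z‖ - R)⁻¹ := by
    have hle : (‖z‖ - R) * ‖ι v‖ ^ 2 ≤ ‖ι v‖ :=
      calc (‖z‖ - R) * ‖ι v‖ ^ 2 ≤ ‖⟪ι v, ι (S n - ρ • S (n + 1))⟫_𝕜‖ :=
            hv ▸ sub_mul_norm_sq_le_norm_inner hι z v
        _ = ‖⟪ι v, ι (S n)⟫_𝕜‖ := by
            rw [map_sub, map_smul, inner_sub_right, inner_smul_right,
              inner_eq_zero_symm.1 horth, mul_zero, sub_zero]
        _ ≤ ‖ι v‖ * ‖ι (S n)‖ := norm_inner_le_norm _ _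
        _ = ‖ι v‖ := by rw [hS.1 n, mul_one]
    rcases (norm_nonneg (ι v)).eq_or_lt with h0 | hpos
    · rw [← h0]; positivity
    · rw [le_inv_comm₀ hpos hd, ← one_div, le_div_iff₀ hpos]
      nlinarith
  have hρ : ρ = -⟪ι (S (n + 1)), ι (X * v)⟫_𝕜 := by
    have h : ⟪ι (S (n + 1)), ι (S n - ρ • S (n + 1))⟫_𝕜 = ⟪ι (S (n + 1)), ι (X * v)⟫_𝕜 := by
      rw [hv, sub_mul, ← smul_eq_C_mul, map_sub, map_smul, inner_sub_right, inner_smul_right,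
        horth, mul_zero, sub_zero]
    rw [← h, map_sub, map_smul, inner_sub_right, inner_smul_right, hS.2 n.succ_ne_self,
      inner_self_eq_norm_sq_to_K, hS.1]
    simp
  calc ‖ρ‖ ≤ ‖ι (S (n + 1))‖ * ‖ι (X * v)‖ := by
        rw [hρ, norm_neg]; exact norm_inner_le_norm _ _
    _ ≤ R * ‖ι v‖ := by rw [hS.1, one_mul]; exact hι v
    _ ≤ R * (‖z‖ - R)⁻¹ := by gcongr
    _ = R / (‖z‖ - R) := (div_eq_mul_inv _ _).symm

theorem norm_eval_seq_div_add_le (hS : Orthonormal 𝕜 fun n => ι (S n))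
    (hι : ∀ p, ‖ι (X * p)‖ ≤ R * ‖ι p‖) {z : 𝕜} (hz : R < ‖z‖) (n m : ℕ) :
    ‖(S n).eval z / (S (n + m)).eval z‖ ≤ (R / (‖z‖ - R)) ^ m := by
  have hne := eval_seq_ne_zero_of_lt_norm hS hι hz
  have hq : 0 ≤ R / (‖z‖ - R) :=
    div_nonneg (nonneg_of_norm_X_mul_le hS hι) (sub_pos.2 hz).le
  induction m with
  | zero => simp [hne n]
  | succ m ih =>
    rw [← div_mul_div_cancel₀ (hne (n + m)), norm_mul, pow_succ]
    exact mul_le_mul ih (norm_eval_seq_div_succ_le hS hι hz (n + m)) (norm_nonneg _)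
      (by positivity)

theorem tendsto_eval_seq_div_add {z t : 𝕜} (hne : ∀ n, (S n).eval z ≠ 0)
    (ht : Tendsto (fun n => (S n).eval z / (S (n + 1)).eval z) atTop (𝓝 t)) (m : ℕ) :
    Tendsto (fun n => (S n).eval z / (S (n + m)).eval z) atTop (𝓝 (t ^ m)) := by
  induction m with
  | zero => simp [hne]
  | succ m ih =>
    rw [pow_succ]
    exact (ih.mul (ht.comp (tendsto_add_atTop_nat m))).congr fun n =>
      div_mul_div_cancel₀ (hne (n + m))

variable (ι S) in
/-- The coefficient of `S (n + j - m)` in the expansion of `X ^ j * S n`: the entry of the `j`-th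
power of the Hessenberg matrix of multiplication by `X`, indexed by the depth `m` below the leading
term so that the ratio asymptotics fix its limit as `n → ∞`. It is `0` once `m > n + j`. -/
def hessenbergEntry (j n m : ℕ) : 𝕜 :=
  if m ≤ n + j then ⟪ι (S (n + j - m)), ι (X ^ j * S n)⟫_𝕜 else 0

theorem norm_hessenbergEntry_le (hS : Orthonormal 𝕜 fun n => ι (S n))
    (hι : ∀ p, ‖ι (X * p)‖ ≤ R * ‖ι p‖) (j n m : ℕ) : ‖hessenbergEntry ι S j n m‖ ≤ R ^ j := by
  have hR := nonneg_of_norm_X_mul_le hS hι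
  rw [hessenbergEntry]
  split_ifs
  · calc ‖⟪ι (S (n + j - m)), ι (X ^ j * S n)⟫_𝕜‖
        ≤ ‖ι (S (n + j - m))‖ * ‖ι (X ^ j * S n)‖ := norm_inner_le_norm _ _
      _ ≤ 1 * (R ^ j * ‖ι (S n)‖) := by
          rw [hS.1]; gcongr; exact norm_X_pow_mul_le hι hR j (S n)
      _ = R ^ j := by rw [hS.1, one_mul, mul_one]
  · simpa using pow_nonneg hR j

theorem pow_mul_eval_seq_div_eq_tsum (hS : Orthonormal 𝕜 fun n => ι (S n)) (j n : ℕ) (z : 𝕜) :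
    z ^ j * ((S n).eval z / (S (n + j)).eval z) =
      ∑' m, hessenbergEntry ι S j n m * ((S (n + j - m)).eval z / (S (n + j)).eval z) := by
  have hdeg : (X ^ j * S n : 𝕜[X]).degree < (n + j + 1 : ℕ) := by
    rw [degree_mul, degree_X_pow, S.degree_eq]
    norm_cast
    omega
  rw [tsum_eq_sum (s := Finset.range (n + j + 1))]
  · calc z ^ j * ((S n).eval z / (S (n + j)).eval z)
        = (X ^ j * S n : 𝕜[X]).eval z / (S (n + j)).eval z := by simp [mul_div_assoc]
      _ = ∑ k ∈ Finset.range (n + j + 1),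
            ⟪ι (S k), ι (X ^ j * S n)⟫_𝕜 * ((S k).eval z / (S (n + j)).eval z) := by
          conv_lhs => rw [eq_sum_inner_smul_seq hS hdeg]
          simp only [eval_finsetSum, eval_smul, smul_eq_mul, Finset.sum_div, mul_div_assoc]
      _ = _ := by
          rw [← Finset.sum_range_reflect]
          refine Finset.sum_congr rfl fun m hm => ?_
          rw [hessenbergEntry, if_pos (Finset.mem_range_succ_iff.1 hm), Nat.add_sub_cancel]
  · intro m hm
    rw [hessenbergEntry, if_neg (by simpa [Nat.lt_succ_iff] using hm), zero_mul]

theorem pow_mul_pow_eq_tsum_of_tendsto_hessenbergEntry (hS : Orthonormal 𝕜 fun n => ι (S n))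
    (hι : ∀ p, ‖ι (X * p)‖ ≤ R * ‖ι p‖) {z t : 𝕜} (hz : 2 * R < ‖z‖)
    (ht : Tendsto (fun n => (S n).eval z / (S (n + 1)).eval z) atTop (𝓝 t))
    {l : Filter ℕ} [l.NeBot] (hl : l ≤ atTop) {j : ℕ} {c : ℕ → 𝕜}
    (hc : ∀ m, Tendsto (fun n => hessenbergEntry ι S j n m) l (𝓝 (c m))) :
    z ^ j * t ^ j = ∑' m, c m * t ^ m := by
  have hR := nonneg_of_norm_X_mul_le hS hι
  have hzR : R < ‖z‖ := by linarith
  have hd : 0 < ‖z‖ - R := sub_pos.2 hzR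
  have hq : R / (‖z‖ - R) < 1 := (div_lt_one hd).2 (by linarith)
  have hratio (m : ℕ) := tendsto_eval_seq_div_add (eval_seq_ne_zero_of_lt_norm hS hι hzR) ht m
  refine tendsto_nhds_unique (((hratio j).mono_left hl).const_mul (z ^ j)) ?_
  simp only [pow_mul_eval_seq_div_eq_tsum hS]
  refine tendsto_tsum_of_dominated_convergence
    (bound := fun m => R ^ j * (R / (‖z‖ - R)) ^ m)
    ((summable_geometric_of_lt_one (by positivity) hq).mul_left _) (fun m => ?_)
    (Eventually.of_forall fun n m => ?_)
  · refine (hc m).mul (Tendsto.mono_left ?_ hl)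
    have hshift : Tendsto (fun n => n + j - m) atTop atTop :=
      (tendsto_sub_atTop_nat m).comp (tendsto_add_atTop_nat j)
    refine ((hratio m).comp hshift).congr' ?_
    filter_upwards [eventually_ge_atTop m] with n hn
    rw [Function.comp_apply, Nat.sub_add_cancel (by omega)]
  · by_cases hm : m ≤ n + j
    · have hle := norm_eval_seq_div_add_le hS hι hzR (n + j - m) m
      rw [Nat.sub_add_cancel hm] at hle
      rw [norm_mul]
      gcongr
      exact norm_hessenbergEntry_le hS hι j n m
    · rw [hessenbergEntry, if_neg hm, zero_mul, norm_zero]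
      positivity

end OrthonormalPolynomials

section LaurentSeries

theorem isOpen_one_lt_norm : IsOpen {w : ℂ | 1 < ‖w‖} := isOpen_lt continuous_const continuous_norm

theorem isPreconnected_one_lt_norm : IsPreconnected {w : ℂ | 1 < ‖w‖} := by
  have hexp : Complex.exp '' {z : ℂ | 0 < z.re} = {w : ℂ | 1 < ‖w‖} := by
    ext w
    constructor
    · rintro ⟨z, hz, rfl⟩
      simpa [Complex.norm_exp] using hz
    · intro (hw : 1 < ‖w‖)
      refine ⟨Complex.log w, ?_, Complex.exp_log (norm_pos_iff.1 (zero_lt_one.trans hw))⟩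
      change 0 < (Complex.log w).re
      exact Complex.log_re w ▸ Real.log_pos hw
  rw [← hexp]
  exact (convex_halfSpace_re_gt 0).isPreconnected.image _ Complex.continuous_exp.continuousOn

open scoped ENNReal NNReal in
theorem circleAverage_inv_pow_smul_eq_coeff {E : Type*} [NormedAddCommGroup E] [NormedSpace ℂ E]
    [CompleteSpace E] {f : ℂ → E} {p : FormalMultilinearSeries ℂ ℂ E} {c : ℂ} {r : ℝ≥0∞}
    (hf : HasFPowerSeriesOnBall f p c r) {s : ℝ≥0} (hs : 0 < s) (hsr : s < r) (n : ℕ) :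
    Real.circleAverage (fun z => (z - c)⁻¹ ^ n • f z) c s = p.coeff n := by
  have hball : Metric.closedBall c s ⊆ Metric.eball c r := by
    rw [← Metric.closedEBall_coe]
    exact fun z hz => (Metric.mem_closedEBall.1 hz).trans_lt hsr
  have hcauchy := (hf.differentiableOn.mono hball).hasFPowerSeriesOnBall hs
  rw [← hcauchy.hasFPowerSeriesAt.eq_formalMultilinearSeries hf.hasFPowerSeriesAt,
    FormalMultilinearSeries.coeff, Real.circleAverage_eq_circleIntegral (by positivity)]
  simp only [Pi.one_def, cauchyPowerSeries_apply, one_div, smul_comm (_ ^ n : ℂ)]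

theorem hasFPowerSeriesOnBall_tsum_of_norm_le {c : ℕ → ℂ} {B : ℝ} (hc : ∀ m, ‖c m‖ ≤ B) :
    HasFPowerSeriesOnBall (fun u => ∑' m, c m * u ^ m)
      (FormalMultilinearSeries.ofScalars ℂ c) 0 1 := by
  have hr : 1 ≤ (FormalMultilinearSeries.ofScalars ℂ c).radius := by
    refine FormalMultilinearSeries.le_radius_of_bound (r := 1) _ B fun n => ?_
    simpa using hc n
  convert ((FormalMultilinearSeries.ofScalars ℂ c).hasFPowerSeriesOnBall
    (zero_lt_one.trans_le hr)).mono zero_lt_one hr using 1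
  ext u
  simp [FormalMultilinearSeries.sum, mul_comm]

theorem circleAverage_comp_inv {E : Type*} [NormedAddCommGroup E] [NormedSpace ℝ E] (f : ℂ → E)
    (ρ : ℝ) : Real.circleAverage (fun u => f u⁻¹) 0 ρ⁻¹ = Real.circleAverage f 0 ρ := by
  rw [Real.circleAverage_eq_circleAverage_zero_one,
    Real.circleAverage_eq_circleAverage_zero_one (R := ρ), ← Real.circleAverage_zero_one_congr_inv]
  simp [mul_comm]

theorem circleAverage_pow_mul_tsum_inv_pow {c : ℕ → ℂ} {B : ℝ} (hc : ∀ m, ‖c m‖ ≤ B) {ρ : ℝ}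
    (hρ : 1 < ρ) (m : ℕ) :
    Real.circleAverage (fun w => w ^ m * ∑' k, c k * w⁻¹ ^ k) 0 ρ = c m := by
  have hρ1 : ρ⁻¹.toNNReal < (1 : ENNReal) := by
    exact_mod_cast Real.toNNReal_lt_one.2 (inv_lt_one_of_one_lt₀ hρ)
  have hcoeff := circleAverage_inv_pow_smul_eq_coeff (hasFPowerSeriesOnBall_tsum_of_norm_le hc)
    (Real.toNNReal_pos.2 (inv_pos.2 (zero_lt_one.trans hρ))) hρ1 m
  rw [FormalMultilinearSeries.coeff_ofScalars, Real.coe_toNNReal _ (by positivity)] at hcoeff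
  rw [← circleAverage_comp_inv, ← hcoeff]
  simp

theorem eq_circleAverage_of_eventually_eq_tsum {G : ℂ → ℂ}
    (hG : DifferentiableOn ℂ G {w | 1 < ‖w‖}) {c : ℕ → ℂ} {B : ℝ} (hc : ∀ m, ‖c m‖ ≤ B)
    {w₀ : ℂ} (hw₀ : 1 < ‖w₀‖) (hGc : ∀ᶠ w in 𝓝 w₀, G w = ∑' m, c m * w⁻¹ ^ m)
    {ρ : ℝ} (hρ : 1 < ρ) (m : ℕ) :
    c m = Real.circleAverage (fun w => w ^ m * G w) 0 ρ := by
  have hseries : AnalyticOnNhd ℂ (fun w => ∑' m, c m * w⁻¹ ^ m) {w : ℂ | 1 < ‖w‖} := by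
    intro w (hw : 1 < ‖w‖)
    have hw' : w⁻¹ ∈ Metric.eball (0 : ℂ) 1 := by
      rw [← ENNReal.ofReal_one, Metric.eball_ofReal, mem_ball_zero_iff, norm_inv]
      exact inv_lt_one_of_one_lt₀ hw
    exact ((hasFPowerSeriesOnBall_tsum_of_norm_le hc).analyticOnNhd _ hw').comp
      (analyticAt_inv (norm_pos_iff.1 (zero_lt_one.trans hw)))
  have heq : Set.EqOn G (fun w => ∑' m, c m * w⁻¹ ^ m) {w | 1 < ‖w‖} :=
    (hG.analyticOnNhd isOpen_one_lt_norm).eqOn_of_preconnected_of_eventuallyEq hseries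
      isPreconnected_one_lt_norm hw₀ hGc
  rw [← circleAverage_pow_mul_tsum_inv_pow hc hρ m]
  refine Real.circleAverage_congr_sphere fun w hw => ?_
  have hw1 : 1 < ‖w‖ := by
    rwa [mem_sphere_zero_iff_norm.1 hw, abs_of_pos (zero_lt_one.trans hρ)]
  simp only [heq hw1]

end LaurentSeries

section RatioAsymptotics

variable {E : Type*} [NormedAddCommGroup E] [InnerProductSpace ℂ E]
  {ι : ℂ[X] →ₗ[ℂ] E} {S : Polynomial.Sequence ℂ} {R : ℝ} {ψ : ℂ → ℂ} {w₀ : ℂ} {ρ : ℝ}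

theorem tendsto_hessenbergEntry (hS : Orthonormal ℂ fun n => ι (S n))
    (hι : ∀ p, ‖ι (X * p)‖ ≤ R * ‖ι p‖) (hψ : DifferentiableOn ℂ ψ {w | 1 < ‖w‖})
    (hw₀ : 1 < ‖w₀‖) (hψw₀ : 2 * R < ‖ψ w₀‖)
    (hratio : ∀ᶠ w in 𝓝 w₀,
      Tendsto (fun n => (S n).eval (ψ w) / (S (n + 1)).eval (ψ w)) atTop (𝓝 w⁻¹))
    (hρ : 1 < ρ) (j m : ℕ) :
    Tendsto (fun n => hessenbergEntry ι S j n m) atTop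
      (𝓝 (Real.circleAverage (fun w => w ^ m * (ψ w / w) ^ j) 0 ρ)) := by
  suffices hrow : Tendsto (hessenbergEntry ι S j) atTop
      (𝓝 fun m => Real.circleAverage (fun w => w ^ m * (ψ w / w) ^ j) 0 ρ) from
    tendsto_pi_nhds.1 hrow m
  refine (isCompact_univ_pi fun _ => isCompact_closedBall (0 : ℂ) (R ^ j)
    ).tendsto_nhds_of_unique_mapClusterPt (.of_forall fun n m _ => ?_) fun c hc hclus => ?_
  · exact mem_closedBall_zero_iff.2 (norm_hessenbergEntry_le hS hι j n m)
  obtain ⟨u, hu, hlim⟩ := mapClusterPt_iff_ultrafilter.1 hclus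
  have hdiff : DifferentiableOn ℂ (fun w => (ψ w / w) ^ j) {w | 1 < ‖w‖} :=
    (hψ.div differentiableOn_id fun w hw => norm_pos_iff.1 (zero_lt_one.trans hw)).pow j
  have hψ_near : ∀ᶠ w in 𝓝 w₀, 2 * R < ‖ψ w‖ :=
    (hψ.differentiableAt (isOpen_one_lt_norm.mem_nhds hw₀)).continuousAt.norm.eventually_const_lt
      hψw₀
  have hseries : ∀ᶠ w in 𝓝 w₀, (ψ w / w) ^ j = ∑' m, c m * w⁻¹ ^ m := by
    filter_upwards [hratio, hψ_near] with w ht hw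
    rw [div_eq_mul_inv, mul_pow]
    exact pow_mul_pow_eq_tsum_of_tendsto_hessenbergEntry hS hι hw ht hu
      (tendsto_pi_nhds.1 hlim)
  ext m
  exact eq_circleAverage_of_eventually_eq_tsum hdiff
    (fun m => mem_closedBall_zero_iff.1 (hc m trivial)) hw₀ hseries hρ m

theorem tendsto_inner_X_pow_mul_self (hS : Orthonormal ℂ fun n => ι (S n))
    (hι : ∀ p, ‖ι (X * p)‖ ≤ R * ‖ι p‖) (hψ : DifferentiableOn ℂ ψ {w | 1 < ‖w‖})
    (hw₀ : 1 < ‖w₀‖) (hψw₀ : 2 * R < ‖ψ w₀‖)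
    (hratio : ∀ᶠ w in 𝓝 w₀,
      Tendsto (fun n => (S n).eval (ψ w) / (S (n + 1)).eval (ψ w)) atTop (𝓝 w⁻¹))
    (hρ : 1 < ρ) (j : ℕ) :
    Tendsto (fun n => ⟪ι (S n), ι (X ^ j * S n)⟫_ℂ) atTop
      (𝓝 (Real.circleAverage (fun w => ψ w ^ j) 0 ρ)) := by
  have hlim := tendsto_hessenbergEntry hS hι hψ hw₀ hψw₀ hratio hρ j j
  simp only [hessenbergEntry, Nat.le_add_left, if_true, Nat.add_sub_cancel] at hlim
  convert hlim using 2
  refine Real.circleAverage_congr_sphere fun w hw => ?_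
  have hw0 : w ≠ 0 := ne_zero_of_mem_sphere (abs_pos.2 (zero_lt_one.trans hρ).ne').ne' ⟨w, hw⟩
  rw [← mul_pow, mul_div_cancel₀ _ hw0]

end RatioAsymptotics

section InverseFunction

variable {U V : Set ℂ} {φ ψ : ℂ → ℂ} {z : ℂ}

theorem not_eventually_eq_of_injOn (hU : IsOpen U) (hinj : Set.InjOn φ U) (hz : z ∈ U) :
    ¬ ∀ᶠ y in 𝓝 z, φ y = φ z := by
  intro h
  have hfalse : ∀ᶠ _ in 𝓝[≠] z, False := by
    filter_upwards [h.filter_mono nhdsWithin_le_nhds, nhdsWithin_le_nhds (hU.mem_nhds hz),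
      self_mem_nhdsWithin] with _ hy hyU hne using hne (hinj hyU hz hy)
  exact (NormedField.nhdsNE_neBot z).ne (eventually_false_iff_eq_bot.1 hfalse)

theorem nhds_le_map_of_injOn (hU : IsOpen U) (hd : DifferentiableOn ℂ φ U)
    (hinj : Set.InjOn φ U) (hz : z ∈ U) : 𝓝 (φ z) ≤ map φ (𝓝 z) :=
  (hd.analyticAt (hU.mem_nhds hz)).eventually_constant_or_nhds_le_map_nhds.resolve_left
    (not_eventually_eq_of_injOn hU hinj hz)

theorem eventually_deriv_ne_zero_of_injOn (hU : IsOpen U) (hd : DifferentiableOn ℂ φ U)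
    (hinj : Set.InjOn φ U) (hz : z ∈ U) : ∀ᶠ y in 𝓝[≠] z, deriv φ y ≠ 0 := by
  refine (hd.analyticAt (hU.mem_nhds hz)).deriv.eventually_eq_zero_or_eventually_ne_zero
    |>.resolve_left fun h => not_eventually_eq_of_injOn hU hinj hz ?_
  obtain ⟨ε, hε, hball⟩ := Metric.eventually_nhds_iff_ball.1 (h.and (hU.mem_nhds hz))
  filter_upwards [Metric.ball_mem_nhds z hε] with y hy
  exact Metric.isOpen_ball.is_const_of_deriv_eq_zero (convex_ball z ε).isPreconnected
    (hd.mono fun x hx => (hball x hx).2) (fun x hx => (hball x hx).1) hy (Metric.mem_ball_self hε)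

theorem continuousAt_of_invOn (hU : IsOpen U) (hd : DifferentiableOn ℂ φ U)
    (hinv : Set.InvOn ψ φ U V) (hmaps : Set.MapsTo ψ V U) {w : ℂ} (hw : w ∈ V) :
    ContinuousAt ψ w := by
  have hle := nhds_le_map_of_injOn hU hd hinv.1.injOn (hmaps hw)
  rw [hinv.2 hw] at hle
  refine Tendsto.mono_left (tendsto_map'_iff.2 (tendsto_id.congr' ?_)) hle
  filter_upwards [hU.mem_nhds (hmaps hw)] with z hz using (hinv.1 hz).symm

theorem differentiableOn_of_invOn (hU : IsOpen U) (hd : DifferentiableOn ℂ φ U)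
    (hb : Set.BijOn φ U V) (hinv : Set.InvOn ψ φ U V) : DifferentiableOn ℂ ψ V := by
  have hmaps : Set.MapsTo ψ V U := (hb.symm hinv.symm).mapsTo
  have hcont : ∀ w ∈ V, ContinuousAt ψ w := fun w hw => continuousAt_of_invOn hU hd hinv hmaps hw
  have hV : ∀ w ∈ V, V ∈ 𝓝 w := by
    intro w hw
    have hle := nhds_le_map_of_injOn hU hd hb.injOn (hmaps hw)
    rw [hinv.2 hw] at hle
    exact hle (mem_map.2 (mem_of_superset (hU.mem_nhds (hmaps hw)) hb.mapsTo))
  intro w₀ hw₀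
  refine (Complex.analyticAt_of_differentiable_on_punctured_nhds_of_continuousAt ?_
    (hcont w₀ hw₀)).differentiableAt.differentiableWithinAt
  have hψ : Tendsto ψ (𝓝[≠] w₀) (𝓝[≠] (ψ w₀)) := by
    refine tendsto_nhdsWithin_iff.2 ⟨(hcont w₀ hw₀).tendsto.mono_left nhdsWithin_le_nhds, ?_⟩
    filter_upwards [self_mem_nhdsWithin, nhdsWithin_le_nhds (hV w₀ hw₀)] with w hne hw h
    exact hne (hinv.2.injOn hw hw₀ h)
  filter_upwards [hψ.eventually (eventually_deriv_ne_zero_of_injOn hU hd hb.injOn (hmaps hw₀)),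
    nhdsWithin_le_nhds (hV w₀ hw₀)] with w hderiv hw
  refine (HasDerivAt.of_local_left_inverse (hcont w hw)
    (hd.differentiableAt (hU.mem_nhds (hmaps hw))).hasDerivAt hderiv ?_).differentiableAt
  filter_upwards [hV w hw] with y hy using hinv.2 hy

end InverseFunction

section RadialLimits

variable {f : ℂ → ℂ} {a b : ℝ}

theorem ae_of_ae_Ioc_of_periodic {P : ℝ → Prop} {T : ℝ} (hP : Function.Periodic P T) (hT : 0 < T)
    (t : ℝ) (h : ∀ᵐ x, x ∈ Set.Ioc t (t + T) → P x) : ∀ᵐ x, P x := by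
  refine (isAddFundamentalDomain_Ioc hT t).measure_zero_of_invariant _ ?_ ?_
  · rintro ⟨_, n, rfl⟩
    ext x
    have hx : P (-(n • T) + x) = P x := by
      rw [neg_add_eq_sub]; exact hP.sub_zsmul_eq n
    simp only [Set.mem_vadd_set_iff_neg_vadd_mem, AddSubgroup.vadd_def, vadd_eq_add]
    change ¬ P (-(n • T) + x) ↔ ¬ P x
    rw [hx]
  · refine measure_mono_null ?_ h
    rintro x ⟨hx, hmem⟩ himp
    exact hx (himp hmem)

theorem ae_lintegral_ray_lt_top {g : ℂ → ENNReal} (hg : Measurable g) (hfin : ∫⁻ z, g z ≠ ⊤) :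
    ∀ᵐ θ : ℝ, ∫⁻ r in Set.Ioi (0 : ℝ),
      ENNReal.ofReal r * g (r * Complex.exp (θ * Complex.I)) < ⊤ := by
  have hmeas : Measurable fun p : ℝ × ℝ =>
      ENNReal.ofReal p.1 * g (p.1 * Complex.exp (p.2 * Complex.I)) :=
    measurable_fst.ennreal_ofReal.mul (hg.comp (by fun_prop))
  refine ae_of_ae_Ioc_of_periodic (T := 2 * Real.pi) (fun θ => ?_) Real.two_pi_pos (-Real.pi) ?_
  · simp only [Complex.ofReal_add, Complex.ofReal_mul, Complex.ofReal_ofNat, add_mul,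
      Complex.exp_periodic _]
  · have hpolar : ∫⁻ θ in Set.Ioo (-Real.pi) Real.pi, ∫⁻ r in Set.Ioi (0 : ℝ),
        ENNReal.ofReal r * g (r * Complex.exp (θ * Complex.I)) = ∫⁻ z, g z := by
      rw [← Complex.lintegral_comp_polarCoord_symm, polarCoord_target,
        Measure.volume_eq_prod, ← Measure.prod_restrict, ← lintegral_prod_symm' _ hmeas]
      simp only [Complex.polarCoord_symm_apply, smul_eq_mul, Complex.exp_mul_I, Complex.ofReal_cos,
        Complex.ofReal_sin]
    have hae := ae_lt_top hmeas.lintegral_prod_left' (hpolar.trans_ne hfin)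
    rw [restrict_Ioo_eq_restrict_Ioc, ae_restrict_iff' measurableSet_Ioc] at hae
    rwa [show -Real.pi + 2 * Real.pi = Real.pi by ring]

theorem exists_tendsto_nhdsGT_of_integrableOn_deriv {E : Type*} [NormedAddCommGroup E]
    [NormedSpace ℝ E] [CompleteSpace E] {h h' : ℝ → E} (hab : a < b)
    (hd : ∀ s ∈ Set.Ioo a b, HasDerivAt h (h' s) s) (hi : IntegrableOn h' (Set.Ioo a b)) :
    ∃ l, Tendsto h (𝓝[>] a) (𝓝 l) := by
  obtain ⟨c, hac, hcb⟩ := exists_between hab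
  have hprim : Tendsto (fun s => ∫ t in s..c, h' t) (𝓝[>] a) (𝓝 (∫ t in a..c, h' t)) := by
    have hi' : IntegrableOn h' (Set.uIcc a c) := by
      rw [Set.uIcc_of_le hac.le, integrableOn_Icc_iff_integrableOn_Ioc]
      exact hi.mono_set fun x hx => ⟨hx.1, hx.2.trans_lt hcb⟩
    have hcont := intervalIntegral.continuousOn_primitive_interval_left (μ := volume) hi'
    refine (hcont a Set.left_mem_uIcc).mono_left ?_
    rw [Set.uIcc_of_le hac.le, ← nhdsWithin_Ioc_eq_nhdsGT hac]
    exact nhdsWithin_mono _ Set.Ioc_subset_Icc_self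
  refine ⟨h c - ∫ t in a..c, h' t, (tendsto_const_nhds.sub hprim).congr' ?_⟩
  filter_upwards [Ioo_mem_nhdsGT hac] with s hs
  have hsub : Set.uIcc s c ⊆ Set.Ioo a b := by
    rw [Set.uIcc_of_le hs.2.le]
    exact fun x hx => ⟨hs.1.trans_le hx.1, hx.2.trans_lt hcb⟩
  rw [intervalIntegral.integral_eq_sub_of_hasDerivAt (fun x hx => hd x (hsub hx))
    (hi.mono_set hsub).intervalIntegrable, sub_sub_cancel]

theorem lintegral_norm_deriv_sq_eq_volume_image {S : Set ℂ} (hS : IsOpen S)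
    (hd : DifferentiableOn ℂ f S) (hinj : Set.InjOn f S) :
    ∫⁻ z in S, ENNReal.ofReal (‖deriv f z‖ ^ 2) = volume (f '' S) := by
  have hdet : ∀ c : ℂ,
      ((ContinuousLinearMap.toSpanSingleton ℂ c).restrictScalars ℝ).det = ‖c‖ ^ 2 := fun c => by
    simp [ContinuousLinearMap.det, LinearMap.det_restrictScalars, Algebra.norm_complex_apply,
      Complex.normSq_eq_norm_sq]
  rw [← lintegral_abs_det_fderiv_eq_addHaar_image volume hS.measurableSet (fun z hz =>
    (hd.differentiableAt (hS.mem_nhds hz)).hasDerivAt.hasFDerivAt.restrictScalars ℝ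
      |>.hasFDerivWithinAt) hinj]
  simp only [hdet, abs_pow, abs_norm]

theorem norm_ofReal_mul_exp_mul_I {r : ℝ} (hr : 0 < r) (θ : ℝ) :
    ‖(r : ℂ) * Complex.exp (θ * Complex.I)‖ = r := by
  rw [norm_mul, Complex.norm_exp_ofReal_mul_I, mul_one, Complex.norm_of_nonneg hr.le]

theorem isOpen_annulus : IsOpen {w : ℂ | a < ‖w‖ ∧ ‖w‖ < b} :=
  (isOpen_lt continuous_const continuous_norm).inter (isOpen_lt continuous_norm continuous_const)

theorem ofReal_mul_exp_mem_annulus (ha : 0 < a) {r : ℝ} (hr : r ∈ Set.Ioo a b) (θ : ℝ) :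
    (r : ℂ) * Complex.exp (θ * Complex.I) ∈ {w : ℂ | a < ‖w‖ ∧ ‖w‖ < b} := by
  change a < ‖_‖ ∧ ‖_‖ < b
  rwa [norm_ofReal_mul_exp_mul_I (ha.trans hr.1)]

theorem ae_integrableOn_deriv_ray (ha : 0 < a)
    (hd : DifferentiableOn ℂ f {w | a < ‖w‖ ∧ ‖w‖ < b})
    (hinj : Set.InjOn f {w | a < ‖w‖ ∧ ‖w‖ < b})
    (hvol : volume (f '' {w | a < ‖w‖ ∧ ‖w‖ < b}) ≠ ⊤) :
    ∀ᵐ θ : ℝ, IntegrableOn (fun r : ℝ => deriv f (r * Complex.exp (θ * Complex.I)))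
      (Set.Ioo a b) := by
  rw [← lintegral_norm_deriv_sq_eq_volume_image isOpen_annulus hd hinj,
    ← lintegral_indicator isOpen_annulus.measurableSet] at hvol
  have hmeas := (measurable_deriv f).norm.pow_const 2 |>.ennreal_ofReal
  filter_upwards [ae_lintegral_ray_lt_top (hmeas.indicator isOpen_annulus.measurableSet) hvol]
    with θ hθ
  have hm : Measurable fun r : ℝ => deriv f (r * Complex.exp (θ * Complex.I)) :=
    (measurable_deriv f).comp (by fun_prop)
  have hsq : IntegrableOn (fun r : ℝ => r * ‖deriv f (r * Complex.exp (θ * Complex.I))‖ ^ 2)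
      (Set.Ioo a b) := by
    refine ⟨(measurable_id.mul (hm.norm.pow_const 2)).aestronglyMeasurable, ?_⟩
    rw [hasFiniteIntegral_iff_ofReal (ae_restrict_of_forall_mem measurableSet_Ioo fun r hr =>
      mul_nonneg (ha.trans hr.1).le (sq_nonneg _))]
    refine lt_of_eq_of_lt (setLIntegral_congr_fun measurableSet_Ioo fun r hr => ?_)
      ((lintegral_mono_set fun r hr => ha.trans hr.1).trans_lt hθ)
    have hr0 : 0 < r := ha.trans hr.1
    rw [Set.indicator_of_mem (ofReal_mul_exp_mem_annulus ha hr θ), ENNReal.ofReal_mul hr0.le]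
  refine Integrable.mono' ((integrableOn_const (by simp) (C := a⁻¹)).add hsq)
    hm.aestronglyMeasurable (ae_restrict_of_forall_mem measurableSet_Ioo fun r hr => ?_)
  have hr0 : 0 < r := ha.trans hr.1
  set x := ‖deriv f (r * Complex.exp (θ * Complex.I))‖
  calc x ≤ r⁻¹ + r * x ^ 2 := by
        have hsquare : r * (x - r⁻¹) ^ 2 = r * x ^ 2 - 2 * x + r⁻¹ := by field_simp; ring
        have hx : 0 ≤ x := norm_nonneg _
        linarith [mul_nonneg hr0.le (sq_nonneg (x - r⁻¹))]
    _ ≤ a⁻¹ + r * x ^ 2 := by gcongr; exact hr.1.le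

theorem ae_exists_radial_limit (ha : 0 < a) (hab : a < b)
    (hd : DifferentiableOn ℂ f {w | a < ‖w‖ ∧ ‖w‖ < b})
    (hinj : Set.InjOn f {w | a < ‖w‖ ∧ ‖w‖ < b})
    (hvol : volume (f '' {w | a < ‖w‖ ∧ ‖w‖ < b}) ≠ ⊤) :
    ∀ᵐ θ : ℝ, ∃ l, Tendsto (fun r : ℝ => f (r * Complex.exp (θ * Complex.I))) (𝓝[>] a) (𝓝 l) := by
  filter_upwards [ae_integrableOn_deriv_ray ha hd hinj hvol] with θ hθ
  refine exists_tendsto_nhdsGT_of_integrableOn_deriv hab (fun r hr => ?_)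
    (hθ.mul_const (Complex.exp (θ * Complex.I)))
  have hline := (hasDerivAt_id (r : ℂ)).mul_const (Complex.exp (θ * Complex.I))
  have hf := (hd.differentiableAt
    (isOpen_annulus.mem_nhds (ofReal_mul_exp_mem_annulus ha hr θ))).hasDerivAt
  simpa using (hf.comp (r : ℂ) hline).comp_ofReal

end RadialLimits

section BoundaryIntegral

variable {F : ℂ → ℂ} {b : ℝ → ℂ} {M R ρ : ℝ}

theorem circleAverage_eq_of_differentiableOn (hF : DifferentiableOn ℂ F {w | 1 < ‖w‖})
    {r : ℝ} (hr : 1 < r) (hρ : r ≤ ρ) :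
    Real.circleAverage F 0 ρ = Real.circleAverage F 0 r := by
  rw [Real.circleAverage_eq_circleIntegral (by linarith),
    Real.circleAverage_eq_circleIntegral (by linarith),
    Complex.circleIntegral_sub_center_inv_smul_eq_of_differentiable_on_annulus_off_countable
      (by linarith) hρ Set.countable_empty
      (hF.continuousOn.mono fun z hz => hr.trans_le (by simpa using hz.2))
      fun z hz => hF.differentiableAt
        (isOpen_one_lt_norm.mem_nhds (hr.trans (by simpa using hz.1.2)))]

theorem continuous_comp_circle (hF : DifferentiableOn ℂ F {w | 1 < ‖w‖}) {r : ℝ} (hr : 1 < r) :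
    Continuous fun θ : ℝ => F (r * Complex.exp (θ * Complex.I)) :=
  hF.continuousOn.comp_continuous (by fun_prop) fun θ =>
    hr.trans_eq (norm_ofReal_mul_exp_mul_I (zero_lt_one.trans hr) θ).symm

theorem aestronglyMeasurable_of_tendsto_radial
    (hF : DifferentiableOn ℂ F {w | 1 < ‖w‖})
    (hb : ∀ᵐ θ : ℝ, Tendsto (fun r : ℝ => F (r * Complex.exp (θ * Complex.I))) (𝓝[>] 1)
      (𝓝 (b θ))) : AEStronglyMeasurable b volume := by
  obtain ⟨u, -, hu1, hu⟩ := exists_seq_strictAnti_tendsto' (show (1 : ℝ) < 2 by norm_num)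
  have hu' : Tendsto u atTop (𝓝[>] 1) :=
    tendsto_nhdsWithin_iff.2 ⟨hu, Eventually.of_forall fun n => (hu1 n).1⟩
  exact aestronglyMeasurable_of_tendsto_ae atTop
    (fun n => (continuous_comp_circle hF (hu1 n).1).aestronglyMeasurable)
    (hb.mono fun θ hθ => hθ.comp hu')

theorem norm_comp_circle_le (hM : ∀ w : ℂ, 1 < ‖w‖ → ‖w‖ < R → ‖F w‖ ≤ M) {r : ℝ}
    (hr : r ∈ Set.Ioo 1 R) (θ : ℝ) : ‖F (r * Complex.exp (θ * Complex.I))‖ ≤ M := by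
  have hnorm := norm_ofReal_mul_exp_mul_I (zero_lt_one.trans hr.1) θ
  exact hM _ (hr.1.trans_eq hnorm.symm) (hnorm.trans_lt hr.2)

theorem intervalIntegrable_of_tendsto_radial (hR : 1 < R)
    (hF : DifferentiableOn ℂ F {w | 1 < ‖w‖})
    (hM : ∀ w : ℂ, 1 < ‖w‖ → ‖w‖ < R → ‖F w‖ ≤ M)
    (hb : ∀ᵐ θ : ℝ, Tendsto (fun r : ℝ => F (r * Complex.exp (θ * Complex.I))) (𝓝[>] 1)
      (𝓝 (b θ))) (s t : ℝ) : IntervalIntegrable b volume s t := by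
  have hbM : ∀ᵐ θ : ℝ, ‖b θ‖ ≤ M := by
    filter_upwards [hb] with θ hθ
    refine le_of_tendsto hθ.norm ?_
    filter_upwards [Ioo_mem_nhdsGT hR] with r hr using norm_comp_circle_le hM hr θ
  exact intervalIntegrable_const.mono_fun' (aestronglyMeasurable_of_tendsto_radial hF hb).restrict
    (ae_restrict_of_ae hbM)

theorem integral_div_two_pi_eq_circleAverage_of_tendsto_radial (hR : 1 < R) (hρ : R ≤ ρ)
    (hF : DifferentiableOn ℂ F {w | 1 < ‖w‖})
    (hM : ∀ w : ℂ, 1 < ‖w‖ → ‖w‖ < R → ‖F w‖ ≤ M)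
    (hb : ∀ᵐ θ : ℝ, Tendsto (fun r : ℝ => F (r * Complex.exp (θ * Complex.I))) (𝓝[>] 1)
      (𝓝 (b θ))) :
    ∫ θ in (0 : ℝ)..(2 * Real.pi), b θ / (2 * Real.pi) = Real.circleAverage F 0 ρ := by
  have hnear : ∀ᶠ r : ℝ in 𝓝[>] 1, r ∈ Set.Ioo 1 R := Ioo_mem_nhdsGT hR
  have hlim : Tendsto (fun r : ℝ => ∫ θ in (0 : ℝ)..(2 * Real.pi),
      F (r * Complex.exp (θ * Complex.I))) (𝓝[>] 1) (𝓝 (∫ θ in (0 : ℝ)..(2 * Real.pi), b θ)) :=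
    intervalIntegral.tendsto_integral_filter_of_dominated_convergence (fun _ => M)
      (hnear.mono fun r hr => (continuous_comp_circle hF hr.1).aestronglyMeasurable)
      (hnear.mono fun r hr => ae_of_all _ fun θ _ => norm_comp_circle_le hM hr θ)
      intervalIntegrable_const (hb.mono fun θ hθ _ => hθ)
  rw [intervalIntegral.integral_div]
  refine tendsto_nhds_unique (hlim.div_const _) (tendsto_const_nhds.congr' ?_)
  filter_upwards [hnear] with r hr
  rw [circleAverage_eq_of_differentiableOn hF hr.1 (hr.2.le.trans hρ), Real.circleAverage]
  simp only [circleMap, zero_add, Complex.real_smul, Complex.ofReal_inv, Complex.ofReal_mul,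
    Complex.ofReal_ofNat, inv_mul_eq_div]

end BoundaryIntegral

section PolynomialsInLp

variable {μ : Measure ℂ} [IsFiniteMeasure μ]

theorem memLp_of_continuous_of_isCompact_support {E : Type*} [NormedAddCommGroup E]
    (hc : IsCompact μ.support) {f : ℂ → E} (hf : Continuous f) (p : ENNReal) : MemLp f p μ := by
  obtain ⟨B, hB⟩ := hc.exists_bound_of_continuousOn hf.continuousOn
  refine MemLp.of_bound hf.aestronglyMeasurable B ?_
  filter_upwards [Measure.support_mem_ae] with z hz using hB z hz

/-- The map sending a polynomial to its class in `L²(μ)`. -/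
def polyToLp (hc : IsCompact μ.support) : ℂ[X] →ₗ[ℂ] Lp ℂ 2 μ where
  toFun p := (memLp_of_continuous_of_isCompact_support hc p.continuous 2).toLp _
  map_add' p q := by simp only [eval_add]; rfl
  map_smul' c p := by simp only [eval_smul]; rfl

variable {hc : IsCompact μ.support}

theorem coeFn_polyToLp (p : ℂ[X]) : polyToLp hc p =ᵐ[μ] fun z => p.eval z :=
  (memLp_of_continuous_of_isCompact_support hc p.continuous 2).coeFn_toLp

theorem inner_polyToLp (p q : ℂ[X]) : ⟪polyToLp hc q, polyToLp hc p⟫_ℂ = polyInner μ p q := by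
  rw [L2.inner_def]
  refine integral_congr_ae ?_
  filter_upwards [coeFn_polyToLp (hc := hc) p, coeFn_polyToLp (hc := hc) q] with z hp hq
  rw [hp, hq, RCLike.inner_apply]

theorem norm_polyToLp_eq_sqrt (p : ℂ[X]) :
    ‖polyToLp hc p‖ = √(∫ z, ‖p.eval z‖ ^ 2 ∂μ) := by
  rw [norm_eq_sqrt_re_inner (𝕜 := ℂ), inner_polyToLp, polyInner]
  simp only [Complex.mul_conj, Complex.normSq_eq_norm_sq, integral_complex_ofReal]
  rfl

theorem inner_X_pow_mul_polyToLp_self (j : ℕ) (p : ℂ[X]) :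
    ⟪polyToLp hc p, polyToLp hc (X ^ j * p)⟫_ℂ =
      ∫ z, z ^ j * ((‖p.eval z‖ ^ 2 : ℝ) : ℂ) ∂μ := by
  simp only [inner_polyToLp, polyInner, eval_mul, eval_pow, eval_X, mul_assoc, Complex.mul_conj,
    Complex.normSq_eq_norm_sq]

theorem norm_polyToLp_X_mul_le {R : ℝ} (hR : ∀ z ∈ μ.support, ‖z‖ ≤ R) (p : ℂ[X]) :
    ‖polyToLp hc (X * p)‖ ≤ R * ‖polyToLp hc p‖ := by
  refine Lp.norm_le_mul_norm_of_ae_le_mul ?_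
  filter_upwards [coeFn_polyToLp (hc := hc) p, coeFn_polyToLp (hc := hc) (X * p),
    Measure.support_mem_ae] with z hp hXp hz
  rw [hp, hXp, eval_mul, eval_X, norm_mul]
  gcongr
  exact hR z hz

theorem polyToLp_injective (hi : μ.support.Infinite) : Function.Injective (polyToLp hc) := by
  rw [injective_iff_map_eq_zero]
  intro p hp
  by_contra hne
  refine hi ((p.rootSet_finite ℂ).subset
    (Measure.support_subset_of_isClosed (p.rootSet_finite ℂ).isClosed ?_))
  filter_upwards [coeFn_polyToLp (hc := hc) p, hp ▸ Lp.coeFn_zero ℂ 2 μ] with z hz hz0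
  rw [mem_rootSet]
  exact ⟨hne, by rw [coe_aeval_eq_eval, ← hz, hz0]; rfl⟩

theorem polyToLp_monicOrthoPoly (n : ℕ) : polyToLp hc (monicOrthoPoly μ n) =
    InnerProductSpace.gramSchmidt ℂ (fun k => polyToLp hc (X ^ k)) n := by
  induction n using Nat.strong_induction_on with
  | _ n ih =>
    rw [InnerProductSpace.gramSchmidt_def, Nat.Iio_eq_range, ← Fin.sum_univ_eq_sum_range,
      monicOrthoPoly, map_sub, map_sum]
    congr 1
    refine Finset.sum_congr rfl fun k _ => ?_
    rw [← ih k k.2, Submodule.starProjection_singleton, ← smul_eq_C_mul, map_smul, inner_polyToLp,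
      ← inner_polyToLp (hc := hc) (monicOrthoPoly μ k), inner_self_eq_norm_sq_to_K]
    norm_cast

theorem degree_monicOrthoPoly (μ : Measure ℂ) (n : ℕ) : (monicOrthoPoly μ n).degree = n := by
  induction n using Nat.strong_induction_on with
  | _ n ih =>
    rw [monicOrthoPoly, degree_sub_eq_left_of_degree_lt, degree_X_pow]
    rw [degree_X_pow]
    refine (degree_sum_le _ _).trans_lt ((Finset.sup_lt_iff (WithBot.bot_lt_coe n)).2 fun k _ => ?_)
    rw [← smul_eq_C_mul]
    refine (degree_smul_le _ _).trans_lt ?_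
    rw [ih k k.2]
    exact Nat.cast_lt.2 k.2

theorem polyToLp_orthonormalPoly (n : ℕ) : polyToLp hc (orthonormalPoly μ n) =
    InnerProductSpace.gramSchmidtNormed ℂ (fun k => polyToLp hc (X ^ k)) n := by
  rw [InnerProductSpace.gramSchmidtNormed, ← polyToLp_monicOrthoPoly, norm_polyToLp_eq_sqrt,
    orthonormalPoly, ← smul_eq_C_mul, map_smul, Complex.ofReal_inv]
  rfl

theorem orthonormal_polyToLp_orthonormalPoly (hi : μ.support.Infinite) :
    Orthonormal ℂ fun n => polyToLp hc (orthonormalPoly μ n) := by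
  have hX : LinearIndependent ℂ fun k : ℕ => (X ^ k : ℂ[X]) := by
    simpa [coe_basisMonomials, X_pow_eq_monomial] using (basisMonomials ℂ).linearIndependent
  simp only [polyToLp_orthonormalPoly]
  exact InnerProductSpace.gramSchmidtNormed_orthonormal
    (hX.map' _ (LinearMap.ker_eq_bot.2 (polyToLp_injective hi)))

/-- The orthonormal polynomials as a sequence of polynomials with `deg φ_n = n`; this needs an
infinite support, since otherwise some `Φ_n` vanishes in `L²(μ)` and so does its normalization. -/
def orthonormalPolySeq (hc : IsCompact μ.support) (hi : μ.support.Infinite) :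
    Polynomial.Sequence ℂ where
  elems' := orthonormalPoly μ
  degree_eq' n := by
    have hne : polyToLp hc (monicOrthoPoly μ n) ≠ 0 :=
      (map_ne_zero_iff _ (polyToLp_injective hi)).2
        (degree_ne_bot.1 (by rw [degree_monicOrthoPoly]; exact WithBot.coe_ne_bot))
    rw [orthonormalPoly, degree_C_mul, degree_monicOrthoPoly]
    rw [← norm_polyToLp_eq_sqrt (hc := hc)]
    exact Complex.ofReal_ne_zero.2 (inv_ne_zero (norm_ne_zero_iff.2 hne))

end PolynomialsInLp

namespace IsExteriorConformalMap

variable {K : Set ℂ} {φ ψ : ℂ → ℂ}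

theorem differentiableOn_inverse (hφ : IsExteriorConformalMap K φ) (hK : IsClosed K)
    (hψ : Set.InvOn ψ φ Kᶜ {w | 1 < ‖w‖}) : DifferentiableOn ℂ ψ {w | 1 < ‖w‖} :=
  differentiableOn_of_invOn hK.isOpen_compl hφ.differentiableOn hφ.bijOn hψ

theorem exists_norm_inverse_le (hφ : IsExteriorConformalMap K φ)
    (hψ : Set.RightInvOn ψ φ {w | 1 < ‖w‖}) (R : ℝ) :
    ∃ M, ∀ w, 1 < ‖w‖ → ‖w‖ < R → ‖ψ w‖ ≤ M := by
  have hcob : {z : ℂ | R ≤ ‖φ z‖} ∈ Bornology.cobounded ℂ :=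
    (tendsto_norm_cobounded_atTop.comp hφ.map_infty).eventually_ge_atTop R
  obtain ⟨M, hM⟩ := (Bornology.isBounded_compl_iff.2 hcob).exists_norm_le
  refine ⟨M, fun w hw hwR => hM _ fun (hle : R ≤ ‖φ (ψ w)‖) => hwR.not_ge ?_⟩
  rwa [hψ hw] at hle

theorem exists_lt_norm_inverse (hφ : IsExteriorConformalMap K φ) (hK : Bornology.IsBounded K)
    (hψ : Set.LeftInvOn ψ φ Kᶜ) (R : ℝ) : ∃ w, 1 < ‖w‖ ∧ R < ‖ψ w‖ := by
  obtain ⟨B, hB⟩ := hK.exists_norm_le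
  obtain ⟨z, hz⟩ := NormedField.exists_lt_norm ℂ (max B R)
  have hzK : z ∈ Kᶜ := fun h => (hB z h).not_gt ((le_max_left B R).trans_lt hz)
  refine ⟨φ z, hφ.bijOn.mapsTo hzK, ?_⟩
  rw [hψ hzK]
  exact (le_max_right B R).trans_lt hz

theorem ae_tendsto_exteriorBoundaryValue (hφ : IsExteriorConformalMap K φ) (hK : IsClosed K)
    (hψ : Set.InvOn ψ φ Kᶜ {w | 1 < ‖w‖}) :
    ∀ᵐ θ : ℝ, Tendsto (fun r : ℝ => ψ ((r : ℂ) * Complex.exp (θ * Complex.I))) (𝓝[>] (1 : ℝ))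
      (𝓝 (exteriorBoundaryValue ψ (Complex.exp (θ * Complex.I)))) := by
  obtain ⟨M, hM⟩ := hφ.exists_norm_inverse_le hψ.2 2
  have hbdd : Bornology.IsBounded (ψ '' {w | 1 < ‖w‖ ∧ ‖w‖ < 2}) := by
    refine isBounded_iff_forall_norm_le.2 ⟨M, ?_⟩
    rintro _ ⟨w, hw, rfl⟩
    exact hM w hw.1 hw.2
  have hsub : {w : ℂ | 1 < ‖w‖ ∧ ‖w‖ < 2} ⊆ {w | 1 < ‖w‖} := fun w hw => hw.1
  filter_upwards [ae_exists_radial_limit zero_lt_one one_lt_two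
    ((hφ.differentiableOn_inverse hK hψ).mono hsub) (hψ.2.injOn.mono hsub)
    hbdd.measure_lt_top.ne] with θ hθ using tendsto_nhds_limUnder hθ

end IsExteriorConformalMap

theorem tendsto_moment_orthonormalPoly {μ : Measure ℂ} [IsFiniteMeasure μ]
    (hc : IsCompact μ.support) (hi : μ.support.Infinite) {ψ : ℂ → ℂ} {R₀ ρ : ℝ}
    (hψ : DifferentiableOn ℂ ψ {w | 1 < ‖w‖}) (hunbdd : ∀ R, ∃ w, 1 < ‖w‖ ∧ R < ‖ψ w‖)
    (hratio : ∀ w, 1 < ‖w‖ → R₀ < ‖ψ w‖ → Tendsto (fun n =>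
      (orthonormalPoly μ n).eval (ψ w) / (orthonormalPoly μ (n + 1)).eval (ψ w)) atTop (𝓝 w⁻¹))
    (hρ : 1 < ρ) (j : ℕ) :
    Tendsto (fun n => ∫ z, z ^ j * ((‖(orthonormalPoly μ n).eval z‖ ^ 2 : ℝ) : ℂ) ∂μ) atTop
      (𝓝 (Real.circleAverage (fun w => ψ w ^ j) 0 ρ)) := by
  obtain ⟨R, hR⟩ := hc.isBounded.exists_norm_le
  obtain ⟨w₀, hw₀, hψw₀⟩ := hunbdd (max R₀ (2 * R))
  have hnear : ∀ᶠ w in 𝓝 w₀, R₀ < ‖ψ w‖ :=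
    (hψ.differentiableAt (isOpen_one_lt_norm.mem_nhds hw₀)).continuousAt.norm.eventually_const_lt
      ((le_max_left _ _).trans_lt hψw₀)
  simp only [← inner_X_pow_mul_polyToLp_self (hc := hc)]
  refine tendsto_inner_X_pow_mul_self (S := orthonormalPolySeq hc hi)
    (orthonormal_polyToLp_orthonormalPoly hi) (norm_polyToLp_X_mul_le hR) hψ hw₀
    ((le_max_right _ _).trans_lt hψw₀) ?_ hρ j
  filter_upwards [hnear, isOpen_one_lt_norm.mem_nhds hw₀] with w hw hw1 using hratio w hw1 hw

theorem theorem1p8_general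
    (μ : Measure ℂ) [IsFiniteMeasure μ]
    (hμ_compact : IsCompact μ.support) (hμ_inf : μ.support.Infinite)
    (K : Set ℂ) (hK : IsCompact K)
    (φ ψ : ℂ → ℂ) (hφ : IsExteriorConformalMap K φ)
    (hψ : Set.InvOn ψ φ Kᶜ {w : ℂ | 1 < ‖w‖})
    (hratio : ∃ R : ℝ, ∀ z : ℂ, R < ‖z‖ →
      Tendsto (fun n : ℕ => (orthonormalPoly μ n).eval z / (orthonormalPoly μ (n + 1)).eval z)
        atTop (𝓝 (1 / φ z))) :
    (∀ᵐ θ : ℝ, Tendsto (fun r : ℝ => ψ ((r : ℂ) * Complex.exp (θ * Complex.I))) (𝓝[>] (1 : ℝ))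
      (𝓝 (exteriorBoundaryValue ψ (Complex.exp (θ * Complex.I))))) ∧
    ∀ j : ℕ,
      IntervalIntegrable
        (fun θ : ℝ => exteriorBoundaryValue ψ (Complex.exp (θ * Complex.I)) ^ j)
        volume 0 (2 * Real.pi) ∧
      Tendsto
        (fun n : ℕ => ∫ z, z ^ j * ((‖(orthonormalPoly μ n).eval z‖ ^ 2 : ℝ) : ℂ) ∂μ)
        atTop
        (𝓝 (∫ θ in (0 : ℝ)..(2 * Real.pi),
          exteriorBoundaryValue ψ (Complex.exp (θ * Complex.I)) ^ j / (2 * Real.pi))) := by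
  obtain ⟨R, hR⟩ := hratio
  obtain ⟨M, hM⟩ := hφ.exists_norm_inverse_le hψ.2 2
  have hd := hφ.differentiableOn_inverse hK.isClosed hψ
  have hbv := hφ.ae_tendsto_exteriorBoundaryValue hK.isClosed hψ
  refine ⟨hbv, fun j => ?_⟩
  have hMj : ∀ w : ℂ, 1 < ‖w‖ → ‖w‖ < 2 → ‖ψ w ^ j‖ ≤ M ^ j := fun w hw hw2 => by
    rw [norm_pow]
    exact pow_le_pow_left₀ (norm_nonneg _) (hM w hw hw2) j
  have hbvj := hbv.mono fun θ hθ => hθ.pow j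
  refine ⟨intervalIntegrable_of_tendsto_radial one_lt_two (hd.pow j) hMj hbvj _ _, ?_⟩
  rw [integral_div_two_pi_eq_circleAverage_of_tendsto_radial one_lt_two le_rfl (hd.pow j) hMj hbvj]
  refine tendsto_moment_orthonormalPoly (R₀ := R) hμ_compact hμ_inf hd
    (hφ.exists_lt_norm_inverse hK.isBounded hψ.1) (fun w hw hRw => ?_) one_lt_two j
  simpa only [hψ.2 hw, one_div] using hR _ hRw

end

theorem theorem1p8
    (μ : Measure ℂ) [IsFiniteMeasure μ]
    (hμ_compact : IsCompact μ.support) (hμ_inf : μ.support.Infinite)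
    (K : Set ℂ) (hK : IsCompact K) (hJ : IsJordanCurve (frontier K))
    (φ ψ : ℂ → ℂ) (hφ : IsExteriorConformalMap K φ)
    (hψ : Set.InvOn ψ φ Kᶜ {w : ℂ | 1 < ‖w‖})
    (hratio : ∃ R : ℝ, ∀ z : ℂ, R < ‖z‖ →
      Tendsto (fun n : ℕ => (orthonormalPoly μ n).eval z / (orthonormalPoly μ (n + 1)).eval z)
        atTop (𝓝 (1 / φ z))) :
    -- the boundary values `ψ (exp (i θ))` exist for almost every `θ`
    (∀ᵐ θ : ℝ, Tendsto (fun r : ℝ => ψ ((r : ℂ) * Complex.exp (θ * Complex.I))) (𝓝[>] (1 : ℝ))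
      (𝓝 (exteriorBoundaryValue ψ (Complex.exp (θ * Complex.I))))) ∧
    ∀ j : ℕ,
      IntervalIntegrable
        (fun θ : ℝ => exteriorBoundaryValue ψ (Complex.exp (θ * Complex.I)) ^ j)
        volume 0 (2 * Real.pi) ∧
      Tendsto
        (fun n : ℕ => ∫ z, z ^ j * ((‖(orthonormalPoly μ n).eval z‖ ^ 2 : ℝ) : ℂ) ∂μ)
        atTop
        (𝓝 (∫ θ in (0 : ℝ)..(2 * Real.pi),
          exteriorBoundaryValue ψ (Complex.exp (θ * Complex.I)) ^ j / (2 * Real.pi))) :=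
  theorem1p8_general μ hμ_compact hμ_inf K hK φ ψ hφ hψ hratio
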